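/- All graphs are finite; loops and parallel edges are allowed. For a graph $G$ let $\Delta G=|E(G)|-|V(G)|$, for $X\subseteq E(G)$ let $G\langle X\rangle$ be the subgraph formed by the edges in $X$ and their ends, and for a vertex $x$ let $S(x,G)$ be the set of edges incident to $x$ and $s(x,G)=|S(x,G)|$. A leaf is a vertex of degree one (a loop adds two to the degree). A graph is a cacti-graph if it has no isolated vertices, no leaves, and no component that is a cycle (a loop at a vertex and a pair of parallel edges form cycles); a cactus is a connected cacti-graph. For $k\ge 1$ the $k$-circular matroid $M_k(G)$ is the matroid on $E(G)$ whose circuits are the sets $C\subseteq E(G)$ such that $\Delta (G\langle C\rangle)=k$ and $G\langle C\rangle$ is a cacti-graph; $\rho^*_k(G)$ is its corank, i.e. the rank of the dual matroid. A matroid is connected if its ground set is non-empty, it has no loops and no coloops, and every two of its elements belong to a common circuit. A cocircuit $K$ of a connected matroid $M$ is non-separating if $M\setminus K$ is connected. **Theorem.** Let $G$ be a finite graph without isolated vertices and let $k\ge 1$. Suppose that $M_k(G)$ is a connected matroid, and let $K$ be a set of edges. Then the following are equivalent: (c1) $K$ is a non-separating cocircuit of $M_k(G)$; (c2) there is a vertex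 $x\in V(G)$ such that $K=S(x,G)$, $s(x,G)\le\rho^*_k(G)$, and $G\setminus x$ is a cactus if $k=1$, and a cacti-graph if $k\ge 2$. -/

import Mathlib

open scoped Matroid

namespace Graph

variable {α β : Type*}

/-- `Δ G = |E(G)| - |V(G)|` (for a finite graph `G`). -/
noncomputable def excess (G : Graph α β) : ℤ := (G.edgeSet.ncard : ℤ) - (G.vertexSet.ncard : ℤ)

/-- The degree of a vertex of a finite graph; a loop counts twice. -/
noncomputable def degree (G : Graph α β) (v : α) : ℕ :=
  (G.incidenceSet v).ncard + (G.loopSet v).ncard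

/-- An isolated vertex: no edge is incident to it. -/
def IsIsolated (G : Graph α β) (v : α) : Prop := v ∈ G.vertexSet ∧ G.incidenceSet v = ∅

/-- A leaf: a vertex of degree one. -/
def IsLeaf (G : Graph α β) (v : α) : Prop := v ∈ G.vertexSet ∧ G.degree v = 1

/-- The graph is non-empty and any two vertices are joined by a walk. -/
def IsConnected (G : Graph α β) : Prop :=
  G.vertexSet.Nonempty ∧
    ∀ x ∈ G.vertexSet, ∀ y ∈ G.vertexSet, Relation.ReflTransGen G.Adj x y

/-- The connected component of `G` that contains the vertex `v`. -/
def component (G : Graph α β) (v : α) : Graph α β :=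
  G.induce {w | w ∈ G.vertexSet ∧ Relation.ReflTransGen G.Adj v w}

/-- A (finite) graph is a cycle if it is connected and 2-regular. A vertex with one loop and a
pair of vertices joined by two parallel edges are cycles. -/
def IsCycle (G : Graph α β) : Prop := G.IsConnected ∧ ∀ v ∈ G.vertexSet, G.degree v = 2

/-- A cacti-graph: no isolated vertices, no leaves, no components that are cycles. -/
structure IsCactiGraph (G : Graph α β) : Prop where
  not_isolated : ∀ v, ¬ G.IsIsolated v
  not_leaf : ∀ v, ¬ G.IsLeaf v
  not_cycle : ∀ v ∈ G.vertexSet, ¬ (G.component v).IsCycle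

/-- A cactus: a connected cacti-graph. -/
def IsCactus (G : Graph α β) : Prop := G.IsCactiGraph ∧ G.IsConnected

/-- The set of ends of the edges in `X`. -/
def endSet (G : Graph α β) (X : Set β) : Set α := {v | ∃ e ∈ X, G.Inc e v}

/-- The subgraph `G⟨X⟩` induced by a set `X` of edges: its edges are those in `X`, its vertices
are their ends. -/
def edgeInduce (G : Graph α β) (X : Set β) : Graph α β := (G.restrict X).induce (G.endSet X)

/-- The collection `𝒞_k(G)` of edge sets `C` such that `Δ(G⟨C⟩) = k` and `G⟨C⟩` is a
cacti-graph. -/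
def kCircuits (G : Graph α β) (k : ℕ) : Set (Set β) :=
  {C | C ⊆ G.edgeSet ∧ (G.edgeInduce C).excess = k ∧ (G.edgeInduce C).IsCactiGraph}

section aux

variable {G : Graph α β} {X Y C : Set β} {k : ℕ}

lemma edgeInduce_isLink {e : β} {x y : α} :
    (G.edgeInduce X).IsLink e x y ↔ e ∈ X ∧ G.IsLink e x y := by
  simp only [edgeInduce, induce_isLink, restrict_isLink, endSet, Set.mem_ofPred_eq]
  exact ⟨fun h => h.1, fun h => ⟨h, ⟨e, h.1, h.2.inc_left⟩, ⟨e, h.1, h.2.inc_right⟩⟩⟩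

lemma edgeInduce_inc {e : β} {x : α} : (G.edgeInduce X).Inc e x ↔ e ∈ X ∧ G.Inc e x := by
  simp [Inc, edgeInduce_isLink]

lemma vertexSet_edgeInduce : (G.edgeInduce X).vertexSet = G.endSet X := rfl

lemma edgeSet_edgeInduce (hX : X ⊆ G.edgeSet) : (G.edgeInduce X).edgeSet = X := by
  ext e
  rw [edge_mem_iff_exists_isLink]
  simp only [edgeInduce_isLink]
  constructor
  · rintro ⟨x, y, h, -⟩
    exact h
  · intro h
    obtain ⟨x, y, hxy⟩ := exists_isLink_of_mem_edgeSet (hX h)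
    exact ⟨x, y, h, hxy⟩

lemma endSet_mono (h : X ⊆ Y) : G.endSet X ⊆ G.endSet Y :=
  fun _ ⟨e, he, hv⟩ => ⟨e, h he, hv⟩

lemma endSet_union : G.endSet (X ∪ Y) = G.endSet X ∪ G.endSet Y := by
  ext v
  simp only [endSet, Set.mem_ofPred_eq, Set.mem_union]
  grind

lemma endSet_finite (hX : X.Finite) : (G.endSet X).Finite := by
  have : G.endSet X = ⋃ e ∈ X, {v | G.Inc e v} := by
    ext v
    simp [endSet]
  rw [this]
  refine hX.biUnion fun e _ => ?_
  by_cases he : e ∈ G.edgeSet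
  · obtain ⟨x, y, h⟩ := exists_isLink_of_mem_edgeSet he
    exact (Set.toFinite {x, y}).subset fun v hv => by
      simpa using Inc.eq_or_eq_of_isLink hv h
  · simp [he]

open Classical in
/-- The number of ends (with multiplicity) of the edge `e` in `W`. -/
noncomputable def endCount (G : Graph α β) (W : Finset α) (e : β) : ℕ :=
  ∑ w ∈ W, ((if G.Inc e w then 1 else 0) + (if G.IsLoopAt e w then 1 else 0))

open Classical in
lemma endCount_eq {W : Finset α} {e : β} {x y : α} (h : G.IsLink e x y) :
    G.endCount W e = (if x ∈ W then 1 else 0) + (if y ∈ W then 1 else 0) := by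
  unfold endCount
  rw [← Finset.sum_ite_eq W x (fun _ => 1), ← Finset.sum_ite_eq W y (fun _ => 1),
    ← Finset.sum_add_distrib]
  refine Finset.sum_congr rfl fun w _ => ?_
  have h1 : G.Inc e w ↔ w = x ∨ w = y :=
    ⟨fun h' => h'.eq_or_eq_of_isLink h, by
      rintro (rfl | rfl)
      · exact h.inc_left
      · exact h.inc_right⟩
  have h2 : G.IsLoopAt e w ↔ w = x ∧ w = y := by
    rw [← isLink_self_iff, h.isLink_iff]
    grind
  rw [if_congr h1 rfl rfl, if_congr h2 rfl rfl]
  by_cases hx : w = x <;> by_cases hy : w = y <;> simp [hx, hy, eq_comm] <;> grind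

open Classical in
lemma sum_degree (hE : G.edgeSet.Finite) (W : Finset α) :
    ∑ w ∈ W, G.degree w = ∑ e ∈ hE.toFinset, G.endCount W e := by
  unfold endCount
  rw [Finset.sum_comm]
  refine Finset.sum_congr rfl fun w _ => ?_
  rw [Finset.sum_add_distrib, ← Finset.card_filter, ← Finset.card_filter, degree]
  congr 1
  · rw [← Set.ncard_coe_finset]
    congr 1
    ext e
    simp only [mem_incidenceSet, Finset.coe_filter, Set.Finite.mem_toFinset, Set.mem_ofPred_eq]
    exact ⟨fun h => ⟨h.edge_mem, h⟩, fun h => h.2⟩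
  · rw [← Set.ncard_coe_finset]
    congr 1
    ext e
    simp only [mem_loopSet, Finset.coe_filter, Set.Finite.mem_toFinset, Set.mem_ofPred_eq]
    exact ⟨fun h => ⟨h.edge_mem, h⟩, fun h => h.2⟩

lemma component_degree {v w : α} (hw : w ∈ (G.component v).vertexSet) :
    (G.component v).degree w = G.degree w := by
  have key : ∀ e y, (G.component v).IsLink e w y ↔ G.IsLink e w y := by
    intro e y
    simp only [component, induce_isLink, and_iff_left_iff_imp]
    intro h
    exact ⟨hw, h.right_mem, hw.2.tail h.adj⟩
  have h1 : (G.component v).incidenceSet w = G.incidenceSet w := by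
    ext e
    simp [Inc, key]
  have h2 : (G.component v).loopSet w = G.loopSet w := by
    ext e
    simp only [mem_loopSet, ← isLink_self_iff, key]
  rw [degree, degree, h1, h2]

/-- Every edge set `Y` with `|Y| ≥ |V(G⟨Y⟩)| + k` contains a member of `𝒞_k(G)`. -/
lemma exists_kCircuit_subset (hE : G.edgeSet.Finite) (hk : 1 ≤ k) (hY : Y ⊆ G.edgeSet)
    (h : (G.endSet Y).ncard + k ≤ Y.ncard) : ∃ C ∈ G.kCircuits k, C ⊆ Y := by
  classical
  induction hn : Y.ncard using Nat.strong_induction_on generalizing Y with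
  | _ n ih =>
  have hYf : Y.Finite := hE.subset hY
  by_cases hsm : ∃ Z ⊂ Y, (G.endSet Z).ncard + k ≤ Z.ncard
  · obtain ⟨Z, hZ, hZk⟩ := hsm
    obtain ⟨C, hC, hCZ⟩ := ih Z.ncard (hn ▸ Set.ncard_lt_ncard hZ hYf)
      (hZ.subset.trans hY) hZk rfl
    exact ⟨C, hC, hCZ.trans hZ.subset⟩
  push Not at hsm
  have hVf := G.endSet_finite hYf
  have hHE := edgeSet_edgeInduce hY
  have hrem : ∀ e ∈ Y, (Y \ {e}).ncard + 1 = Y.ncard ∧ Y \ {e} ⊂ Y := fun e he =>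
    ⟨Set.ncard_sdiff_singleton_add_one he hYf, ⟨Set.sdiff_subset, fun hs => (hs he).2 rfl⟩⟩
  refine ⟨Y, ⟨hY, ?_, ?_, ?_, ?_⟩, subset_rfl⟩
  · rw [excess, hHE, vertexSet_edgeInduce]
    have hne : Y.Nonempty := by
      rw [← Set.ncard_pos hYf]
      omega
    obtain ⟨e, he⟩ := hne
    have h1 := hrem e he
    have h2 := hsm _ h1.2
    have h3 := Set.ncard_le_ncard (endSet_mono (G := G) h1.2.subset) hVf
    omega
  · rintro v ⟨⟨e, he, hv⟩, hi⟩
    have : e ∈ (G.edgeInduce Y).incidenceSet v := edgeInduce_inc.2 ⟨he, hv⟩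
    simp [hi] at this
  · rintro v ⟨hv, hd⟩
    have hfin : ((G.edgeInduce Y).incidenceSet v).Finite :=
      hYf.subset fun e he => (edgeInduce_inc.1 he).1
    have hle := Set.ncard_le_ncard
      ((G.edgeInduce Y).loopSet_subset_incidenceSet v) hfin
    rw [degree] at hd
    have h1 : ((G.edgeInduce Y).incidenceSet v).ncard = 1 := by omega
    obtain ⟨e, he⟩ := Set.ncard_eq_one.1 h1
    have heY : e ∈ Y := by
      have : e ∈ (G.edgeInduce Y).incidenceSet v := by simp [he]
      exact (edgeInduce_inc.1 this).1
    have hsub : G.endSet (Y \ {e}) ⊆ G.endSet Y \ {v} := by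
      rintro u ⟨f, ⟨hf, hfe⟩, hu⟩
      refine ⟨⟨f, hf, hu⟩, ?_⟩
      rintro rfl
      have : f ∈ (G.edgeInduce Y).incidenceSet u := edgeInduce_inc.2 ⟨hf, hu⟩
      rw [he] at this
      exact hfe this
    have h2 := Set.ncard_le_ncard hsub (hVf.subset Set.sdiff_subset)
    have h3 := Set.ncard_sdiff_singleton_add_one (s := G.endSet Y) hv hVf
    have h4 := hrem e heY
    have h5 := hsm _ h4.2
    omega
  · rintro v hv ⟨-, hd⟩
    set H := G.edgeInduce Y with hH
    set W := (H.component v).vertexSet with hW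
    have hWV : W ⊆ G.endSet Y := fun w hw => hw.1
    have hWf : W.Finite := hVf.subset hWV
    have hvW : v ∈ W := ⟨hv, Relation.ReflTransGen.refl⟩
    have hclosed : ∀ e x y, H.IsLink e x y → x ∈ W → y ∈ W := fun e x y hl hx =>
      ⟨hl.right_mem, hx.2.tail hl.adj⟩
    set F := {e ∈ Y | ∃ w ∈ W, G.Inc e w} with hF
    have hFY : F ⊆ Y := Set.sep_subset ..
    have hFf : F.Finite := hYf.subset hFY
    have hHf : H.edgeSet.Finite := hHE ▸ hYf
    have hcount := H.sum_degree hHf hWf.toFinset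
    have hl : ∑ w ∈ hWf.toFinset, H.degree w = W.ncard * 2 := by
      rw [Set.ncard_eq_toFinset_card W hWf]
      refine Finset.sum_const_nat fun w hw => ?_
      have hw' := hWf.mem_toFinset.1 hw
      rw [← component_degree hw']
      exact hd w hw'
    have hr : ∑ e ∈ hHf.toFinset, H.endCount hWf.toFinset e = F.ncard * 2 := by
      have h1 : ∀ e ∈ hHf.toFinset, H.endCount hWf.toFinset e = if e ∈ F then 2 else 0 := by
        intro e he
        have heH : e ∈ H.edgeSet := by simpa using he
        obtain ⟨x, y, hxy⟩ := exists_isLink_of_mem_edgeSet heH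
        have hG := edgeInduce_isLink.1 hxy
        rw [endCount_eq hxy]
        simp only [Set.Finite.mem_toFinset]
        have hxy' : x ∈ W ↔ y ∈ W := ⟨hclosed e x y hxy, hclosed e y x hxy.symm⟩
        have heF : e ∈ F ↔ x ∈ W := by
          constructor
          · rintro ⟨-, w, hw, hi⟩
            rcases hi.eq_or_eq_of_isLink hG.2 with rfl | rfl
            · exact hw
            · exact hxy'.2 hw
          · exact fun hx => ⟨hG.1, x, hx, hG.2.inc_left⟩
        by_cases hx : x ∈ W <;> simp [heF, ← hxy', hx]
      rw [Finset.sum_congr rfl h1, ← Finset.sum_filter, Finset.sum_const, smul_eq_mul,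
        ← Set.ncard_coe_finset]
      congr 2
      ext e
      simp only [Finset.coe_filter, Set.Finite.mem_toFinset, Set.mem_ofPred_eq, hHE]
      exact ⟨fun h => h.2, fun h => ⟨hFY h, h⟩⟩
    have hFW : F.ncard = W.ncard := by omega
    have hWpos : 0 < W.ncard := (Set.ncard_pos hWf).2 ⟨v, hvW⟩
    have hFne : F.Nonempty := by
      rw [← Set.ncard_pos hFf]
      omega
    obtain ⟨f, hf⟩ := hFne
    have hss : Y \ F ⊂ Y := ⟨Set.sdiff_subset, fun hs => (hs (hFY hf)).2 hf⟩
    have hsub : G.endSet (Y \ F) ⊆ G.endSet Y \ W := by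
      rintro u ⟨g, ⟨hg, hgF⟩, hu⟩
      exact ⟨⟨g, hg, hu⟩, fun huW => hgF ⟨hg, u, huW, hu⟩⟩
    have h2 := Set.ncard_le_ncard hsub (hVf.subset Set.sdiff_subset)
    have h3 := Set.ncard_sdiff_add_ncard_of_subset hWV hVf
    have h4 := Set.ncard_sdiff_add_ncard_of_subset hFY hYf
    have h5 := hsm _ hss
    omega

lemma ncard_of_mem_kCircuits (hC : C ∈ G.kCircuits k) :
    C.ncard = (G.endSet C).ncard + k := by
  have h := hC.2.1
  rw [excess, edgeSet_edgeInduce hC.1, vertexSet_edgeInduce] at h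
  omega

/-- An edge set contains no member of `𝒞_k(G)` iff each of its subsets `Y` satisfies
`|Y| ≤ |V(G⟨Y⟩)| + k - 1`. -/
lemma forall_not_kCircuit_iff (hE : G.edgeSet.Finite) (hk : 1 ≤ k) (hX : X ⊆ G.edgeSet) :
    (∀ C ∈ G.kCircuits k, ¬ C ⊆ X) ↔ ∀ Y ⊆ X, Y.ncard + 1 ≤ (G.endSet Y).ncard + k := by
  constructor
  · intro h Y hY
    by_contra hc
    obtain ⟨C, hC, hCY⟩ := exists_kCircuit_subset hE hk (hY.trans hX) (by omega)
    exact h C hC (hCY.trans hY)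
  · intro h C hC hCX
    have h1 := h C hCX
    have h2 := ncard_of_mem_kCircuits hC
    omega

lemma kCircuit_augment (hE : G.edgeSet.Finite) {I J : Set β}
    (hI : I ⊆ G.edgeSet) (hJ : J ⊆ G.edgeSet)
    (hIs : ∀ Y ⊆ I, Y.ncard + 1 ≤ (G.endSet Y).ncard + k)
    (hJs : ∀ Y ⊆ J, Y.ncard + 1 ≤ (G.endSet Y).ncard + k) (hlt : I.ncard < J.ncard) :
    ∃ e ∈ J, e ∉ I ∧ ∀ Y ⊆ insert e I, Y.ncard + 1 ≤ (G.endSet Y).ncard + k := by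
  classical
  by_contra! hcon
  have hIf := hE.subset hI
  have hJf := hE.subset hJ
  have hVf : ∀ Y ⊆ I, (G.endSet Y).Finite := fun Y hY => endSet_finite (hIf.subset hY)
  -- every `e ∈ J \ I` is spanned by a tight subset of `I`
  have htight : ∀ e ∈ J \ I, ∃ T ⊆ I, T.ncard + 1 = (G.endSet T).ncard + k ∧
      G.endSet {e} ⊆ G.endSet T := by
    rintro e ⟨heJ, heI⟩
    obtain ⟨Y, hY, hlt'⟩ := hcon e heJ heI
    have hYf : Y.Finite := (hIf.insert e).subset hY
    have heY : e ∈ Y := by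
      by_contra heY
      have hYI : Y ⊆ I := fun f hf => (hY hf).resolve_left (fun h => heY (h ▸ hf))
      have := hIs Y hYI
      omega
    have hTI : Y \ {e} ⊆ I := fun f hf => (hY hf.1).resolve_left hf.2
    have h1 := hIs _ hTI
    have h2 := Set.ncard_sdiff_singleton_add_one heY hYf
    have hmono : G.endSet (Y \ {e}) ⊆ G.endSet Y := endSet_mono Set.sdiff_subset
    have h3 := Set.ncard_le_ncard hmono (endSet_finite hYf)
    refine ⟨Y \ {e}, hTI, by omega, ?_⟩
    rw [Set.eq_of_subset_of_ncard_le hmono (by omega) (endSet_finite hYf)]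
    exact endSet_mono (by simpa using heY)
  -- the union of two tight subsets is tight
  have hunion : ∀ A ⊆ I, ∀ B ⊆ I, A.ncard + 1 = (G.endSet A).ncard + k →
      B.ncard + 1 = (G.endSet B).ncard + k →
      (A ∪ B).ncard + 1 = (G.endSet (A ∪ B)).ncard + k := by
    intro A hA B hB hAt hBt
    have h1 := Set.ncard_union_add_ncard_inter A B (hIf.subset hA) (hIf.subset hB)
    have h2 := Set.ncard_union_add_ncard_inter (G.endSet A) (G.endSet B) (hVf A hA) (hVf B hB)
    have h3 := hIs (A ∩ B) (Set.inter_subset_left.trans hA)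
    have h4 := Set.ncard_le_ncard (Set.subset_inter
      (endSet_mono (G := G) (Set.inter_subset_left (s := A) (t := B)))
      (endSet_mono Set.inter_subset_right)) ((hVf A hA).subset Set.inter_subset_left)
    have h5 := hIs (A ∪ B) (Set.union_subset hA hB)
    rw [endSet_union] at h5 ⊢
    omega
  have hbig : ∀ S : Finset β, S.Nonempty → (S : Set β) ⊆ J \ I → ∃ T ⊆ I,
      T.ncard + 1 = (G.endSet T).ncard + k ∧ G.endSet (S : Set β) ⊆ G.endSet T := by
    intro S hS
    induction hS using Finset.Nonempty.cons_induction with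
    | singleton a =>
      intro h
      simpa using htight a (h (by simp))
    | cons a s ha hs ih =>
      intro h
      rw [Finset.coe_cons] at h ⊢
      obtain ⟨T₁, hT₁, ht₁, hs₁⟩ := htight a (h (by simp))
      obtain ⟨T₂, hT₂, ht₂, hs₂⟩ := ih ((Set.subset_insert _ _).trans h)
      refine ⟨T₁ ∪ T₂, Set.union_subset hT₁ hT₂, hunion _ hT₁ _ hT₂ ht₁ ht₂, ?_⟩
      rw [Set.insert_eq, endSet_union, endSet_union]
      exact Set.union_subset_union hs₁ hs₂
  have hne : (J \ I).Nonempty := by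
    rw [Set.nonempty_iff_ne_empty]
    intro h
    have := Set.ncard_le_ncard (Set.sdiff_eq_empty.1 h) hIf
    omega
  have hdf : (J \ I).Finite := hJf.subset Set.sdiff_subset
  obtain ⟨T, hT, htT, hsT⟩ := hbig hdf.toFinset (by simpa using hne) (by simp)
  rw [Set.Finite.coe_toFinset] at hsT
  -- compare `J` with `I` inside and outside `T`
  have h1 := hJs ((J \ I) ∪ (J ∩ T)) (Set.union_subset Set.sdiff_subset Set.inter_subset_left)
  have h2 : G.endSet ((J \ I) ∪ (J ∩ T)) ⊆ G.endSet T := by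
    rw [endSet_union]
    exact Set.union_subset hsT (endSet_mono Set.inter_subset_right)
  have h3 := Set.ncard_le_ncard h2 (hVf T hT)
  have h4 : J ⊆ ((J \ I) ∪ (J ∩ T)) ∪ (I \ T) := by
    intro f hf
    by_cases hfI : f ∈ I <;> by_cases hfT : f ∈ T <;> simp [hf, hfI, hfT]
  have h5 := (Set.ncard_le_ncard h4
    (((hdf.union (hJf.subset Set.inter_subset_left))).union
      (hIf.subset Set.sdiff_subset))).trans (Set.ncard_union_le _ _)
  have h6 := Set.ncard_sdiff_add_ncard_of_subset hT hIf
  omega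

/-- No member of `𝒞_k(G)` contains a smaller set that spans at least as much excess. -/
lemma sparse_of_ssubset_kCircuit (hE : G.edgeSet.Finite)
    (hC : C ∈ G.kCircuits k) (hY : Y ⊂ C) : Y.ncard < (G.endSet Y).ncard + k := by
  classical
  obtain ⟨hCE, -, hcact⟩ := id hC
  have hcard := ncard_of_mem_kCircuits hC
  have hCf := hE.subset hCE
  have hVf := G.endSet_finite hCf
  have hHE := edgeSet_edgeInduce hCE
  set H := G.edgeInduce C with hH
  have hHf : H.edgeSet.Finite := hHE ▸ hCf
  set W := G.endSet C \ G.endSet Y with hW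
  have hWf : W.Finite := hVf.subset Set.sdiff_subset
  have hWc := Set.ncard_sdiff_add_ncard_of_subset (endSet_mono (G := G) hY.subset) hVf
  rw [← hW] at hWc
  have hFc := Set.ncard_sdiff_add_ncard_of_subset hY.subset hCf
  have hFf : (C \ Y).Finite := hCf.subset Set.sdiff_subset
  suffices h : W.ncard < (C \ Y).ncard by omega
  have hFpos : 0 < (C \ Y).ncard := by
    rw [Set.ncard_pos hFf]
    exact Set.nonempty_of_ssubset hY
  by_contra! hle
  have hdeg : ∀ w ∈ W, 2 ≤ H.degree w := by
    intro w hw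
    have h1 := hcact.not_leaf w
    have h2 := hcact.not_isolated w
    have hwV : w ∈ H.vertexSet := hw.1
    have hf : (H.incidenceSet w).Finite := hHf.subset (H.incidenceSet_subset_edgeSet w)
    have h3 : (H.incidenceSet w).ncard ≠ 0 := by
      rw [Ne, Set.ncard_eq_zero hf]
      exact fun h => h2 ⟨hwV, h⟩
    have h4 : H.degree w ≠ 1 := fun h => h1 ⟨hwV, h⟩
    rw [degree] at h4 ⊢
    omega
  have hcount := H.sum_degree hHf hWf.toFinset
  have hl : W.ncard * 2 ≤ ∑ w ∈ hWf.toFinset, H.degree w := by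
    rw [Set.ncard_eq_toFinset_card W hWf, ← smul_eq_mul]
    exact Finset.card_nsmul_le_sum _ _ _ fun w hw => hdeg w (by simpa using hw)
  have hec : ∀ e ∈ hHf.toFinset, H.endCount hWf.toFinset e ≤ if e ∈ C \ Y then 2 else 0 := by
    intro e he
    obtain ⟨x, y, hxy⟩ := exists_isLink_of_mem_edgeSet (by simpa using he : e ∈ H.edgeSet)
    have hG := edgeInduce_isLink.1 hxy
    rw [endCount_eq hxy]
    simp only [Set.Finite.mem_toFinset]
    by_cases heY : e ∈ Y
    · have hx : x ∉ W := fun h => h.2 ⟨e, heY, hG.2.inc_left⟩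
      have hy : y ∉ W := fun h => h.2 ⟨e, heY, hG.2.inc_right⟩
      simp [hx, hy]
    · rw [if_pos (show e ∈ C \ Y from ⟨hG.1, heY⟩)]
      split_ifs <;> omega
  have hr : ∑ e ∈ hHf.toFinset, (if e ∈ C \ Y then 2 else 0) = (C \ Y).ncard * 2 := by
    rw [← Finset.sum_filter, Finset.sum_const, smul_eq_mul, ← Set.ncard_coe_finset]
    congr 2
    ext e
    simp only [Finset.coe_filter, Set.Finite.mem_toFinset, Set.mem_ofPred_eq, hHE]
    exact ⟨fun h => h.2, fun h => ⟨h.1, h⟩⟩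
  have hle2 := Finset.sum_le_sum hec
  -- equality holds everywhere
  have heq : ∀ e ∈ hHf.toFinset, H.endCount hWf.toFinset e = if e ∈ C \ Y then 2 else 0 :=
    (Finset.sum_eq_sum_iff_of_le hec).1 (by omega)
  have hdeq : ∀ w ∈ hWf.toFinset, 2 = H.degree w := by
    refine (Finset.sum_eq_sum_iff_of_le fun w hw => hdeg w (by simpa using hw)).1 ?_
    rw [Finset.sum_const, smul_eq_mul, ← Set.ncard_eq_toFinset_card W hWf]
    omega
  have hclosed : ∀ e x y, H.IsLink e x y → x ∈ W → y ∈ W := by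
    intro e x y hxy hx
    have h1 := heq e (by simpa using hxy.edge_mem)
    rw [endCount_eq hxy] at h1
    simp only [Set.Finite.mem_toFinset] at h1
    by_contra hy
    rw [if_pos hx, if_neg hy] at h1
    split_ifs at h1 <;> omega
  have hWne : W.Nonempty := by
    rw [← Set.ncard_pos hWf]
    omega
  obtain ⟨v, hv⟩ := hWne
  have hreach : ∀ w, Relation.ReflTransGen H.Adj v w → w ∈ W := by
    intro w hw
    induction hw with
    | refl => exact hv
    | tail _ h ih =>
      obtain ⟨e, he⟩ := h
      exact hclosed e _ _ he ih
  have hvH : v ∈ H.vertexSet := hv.1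
  refine hcact.not_cycle v hvH ⟨⟨⟨v, hvH, Relation.ReflTransGen.refl⟩, ?_⟩, ?_⟩
  · have hfrom : ∀ w, Relation.ReflTransGen H.Adj v w →
        Relation.ReflTransGen (H.component v).Adj v w := by
      intro w hw
      induction hw with
      | refl => exact Relation.ReflTransGen.refl
      | tail hb h ih =>
        obtain ⟨e, he⟩ := h
        refine ih.tail ⟨e, ?_⟩
        simp only [component, induce_isLink]
        exact ⟨he, ⟨he.left_mem, hb⟩, ⟨he.right_mem, hb.tail he.adj⟩⟩
    intro x hx y hy
    exact (Std.Symm.symm (r := Relation.ReflTransGen (H.component v).Adj) _ _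
      (hfrom x hx.2)).trans (hfrom y hy.2)
  · intro w hw
    rw [component_degree hw]
    exact (hdeq w (by simpa using hreach w hw.2)).symm

end aux

/-- The `k`-circular matroid `M_k(G)` of a graph `G` with finitely many edges, for `k ≥ 1`:
the matroid on `E(G)` whose independent sets are the edge sets that contain no member of
`𝒞_k(G)`. Its circuits are the members of `𝒞_k(G)`, see `kCircularMatroid_isCircuit_iff`. -/
def kCircularMatroid (G : Graph α β) (hE : G.edgeSet.Finite) (k : ℕ) (hk : 1 ≤ k) : Matroid β :=
  (IndepMatroid.ofFinite hE (fun I => I ⊆ G.edgeSet ∧ ∀ C ∈ G.kCircuits k, ¬ C ⊆ I)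
    (by
      refine ⟨Set.empty_subset _, fun C hC hCe => ?_⟩
      have h := ncard_of_mem_kCircuits hC
      rw [Set.subset_empty_iff.1 hCe, Set.ncard_empty] at h
      omega)
    (fun I J hJ hIJ => ⟨hIJ.trans hJ.1, fun C hC hCI => hJ.2 C hC (hCI.trans hIJ)⟩)
    (by
      rintro I J ⟨hI, hI'⟩ ⟨hJ, hJ'⟩ hlt
      rw [forall_not_kCircuit_iff hE hk hI] at hI'
      rw [forall_not_kCircuit_iff hE hk hJ] at hJ'
      obtain ⟨e, heJ, heI, h⟩ := kCircuit_augment hE hI hJ hI' hJ' hlt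
      have hins : insert e I ⊆ G.edgeSet := Set.insert_subset (hJ heJ) hI
      exact ⟨e, heJ, heI, hins, (forall_not_kCircuit_iff hE hk hins).2 h⟩)
    (fun _ h => h.1)).matroid

lemma kCircularMatroid_ground (G : Graph α β) (hE : G.edgeSet.Finite) (k : ℕ) (hk : 1 ≤ k) :
    (G.kCircularMatroid hE k hk).E = G.edgeSet := rfl

lemma kCircularMatroid_indep_iff (G : Graph α β) (hE : G.edgeSet.Finite) (k : ℕ) (hk : 1 ≤ k)
    (I : Set β) : (G.kCircularMatroid hE k hk).Indep I ↔
      I ⊆ G.edgeSet ∧ ∀ C ∈ G.kCircuits k, ¬ C ⊆ I := Iff.rfl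

/-- The circuits of `M_k(G)` are exactly the members of `𝒞_k(G)`. -/
theorem kCircularMatroid_isCircuit_iff (G : Graph α β) (hE : G.edgeSet.Finite) (k : ℕ)
    (hk : 1 ≤ k) (C : Set β) :
    (G.kCircularMatroid hE k hk).IsCircuit C ↔ C ∈ G.kCircuits k := by
  rw [Matroid.isCircuit_iff_forall_ssubset, Matroid.Dep, kCircularMatroid_ground,
    kCircularMatroid_indep_iff]
  constructor
  · rintro ⟨⟨hdep, hCE⟩, hmin⟩
    push Not at hdep
    obtain ⟨D, hD, hDC⟩ := hdep hCE
    rcases hDC.eq_or_ssubset with rfl | hss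
    · exact hD
    · exact absurd subset_rfl
        (((kCircularMatroid_indep_iff G hE k hk D).1 (hmin hss)).2 D hD)
  · intro hC
    refine ⟨⟨fun h => h.2 C hC subset_rfl, hC.1⟩, fun I hI => ?_⟩
    refine (kCircularMatroid_indep_iff G hE k hk I).2 ⟨hI.subset.trans hC.1, fun D hD hDI => ?_⟩
    have h1 := sparse_of_ssubset_kCircuit hE hC (hDI.trans_ssubset hI)
    have h2 := ncard_of_mem_kCircuits hD
    omega

end Graph

namespace Matroid

variable {β : Type*}

/-- A matroid is connected if it is non-empty, has no loops and no coloops, and any two of its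
elements belong to a common circuit. -/
structure IsConnected (M : Matroid β) : Prop where
  nonempty : M.E.Nonempty
  not_isLoop : ∀ e, ¬ M.IsLoop e
  not_isColoop : ∀ e, ¬ M.IsColoop e
  exists_isCircuit : ∀ e ∈ M.E, ∀ f ∈ M.E, e ≠ f → ∃ C, M.IsCircuit C ∧ e ∈ C ∧ f ∈ C

/-- A cocircuit `K` of a (connected) matroid `M` is non-separating if `M \ K` is connected. -/
def IsNonseparatingCocircuit (M : Matroid β) (K : Set β) : Prop :=
  M.IsCocircuit K ∧ (M ＼ K).IsConnected

end Matroid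

/-!
For an edge set `X` put `Δ X = |X| - |V(X)|`. Since `|V(·)|` is submodular, `Δ` is supermodular, and
`G⟨A⟩` is a cacti-graph exactly when `Δ` is strictly smaller on every proper subset of `A`. It
follows that a cacti-graph `G⟨A⟩` with `Δ A ≥ k` has rank `|V(A)| + k - 1` in `M_k(G)`, an upper
bound that holds for every edge set, and that `M_k(G)` restricted to `A` is connected exactly when
`G⟨A⟩` is a cacti-graph with `Δ A ≥ k`, itself connected if `k = 1`: on the two sides of a separator
the ranks add up, which is compatible with the rank formula only for `k = 1` and a vertex-disjoint
union.

The complement `A` of a cocircuit `K` has corank one. If `M_k(G) \ K` is connected, the rank formula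
for `A` and for `E(G)` shows that `A` misses exactly one vertex `x`, so `S(x, G) ⊆ K`; as the
complement of `S(x, G)` does not span, minimality gives `K = S(x, G)`. The bound on `s(x, G)` says
that `Δ A ≥ k`.
-/

namespace KCircular

open Set Graph

section Matroid

variable {β : Type*} {M : Matroid β} {B C₁ C₂ I J K X : Set β} {e f : β}

lemma exists_isCircuit_mem_mem_of_inter_nonempty [M.Finitary] (hC₁ : M.IsCircuit C₁)
    (hC₂ : M.IsCircuit C₂) (he : e ∈ C₁) (hf : f ∈ C₂) (hne : (C₁ ∩ C₂).Nonempty) :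
    ∃ C, M.IsCircuit C ∧ e ∈ C ∧ f ∈ C := by
  induction hn : (C₁ ∪ C₂).ncard using Nat.strong_induction_on generalizing C₁ C₂ with
  | _ n ih =>
  subst hn
  by_cases hf₁ : f ∈ C₁
  · exact ⟨C₁, hC₁, he, hf₁⟩
  by_cases he₂ : e ∈ C₂
  · exact ⟨C₂, hC₂, he₂, hf⟩
  obtain ⟨a, ha₁, ha₂⟩ := hne
  have hfin : (C₁ ∪ C₂).Finite := hC₁.finite.union hC₂.finite
  obtain ⟨C₃, hC₃sub, hC₃, he₃⟩ := hC₁.strong_elimination hC₂ ha₁ ha₂ he he₂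
  obtain ⟨C₄, hC₄sub, hC₄, hf₄⟩ := hC₂.strong_elimination hC₁ ha₂ ha₁ hf hf₁
  have hC₃₁ : ¬ C₃ ⊆ C₁ := fun h => (hC₃sub (hC₃.eq_of_subset_isCircuit hC₁ h ▸ ha₁)).2 rfl
  have hC₄₂ : ¬ C₄ ⊆ C₂ := fun h => (hC₄sub (hC₄.eq_of_subset_isCircuit hC₂ h ▸ ha₂)).2 rfl
  obtain ⟨b, hb₃, hb₁⟩ := not_subset.1 hC₃₁
  obtain ⟨c, hc₄, hc₂⟩ := not_subset.1 hC₄₂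
  have hb₂ : b ∈ C₂ := (hC₃sub hb₃).1.resolve_left hb₁
  have hc₁ : c ∈ C₁ := (hC₄sub hc₄).1.resolve_left hc₂
  have hunion₁₄ : C₁ ∪ C₄ ⊆ C₁ ∪ C₂ := by grind
  have hunion₃₄ : C₃ ∪ C₄ ⊆ (C₁ ∪ C₂) \ {a} := by grind
  -- Either `C₁, C₄` is a smaller pair, or `C₄` contains `C₂ \ C₁` and so meets `C₃`.
  obtain hlt | hge := lt_or_ge (C₁ ∪ C₄).ncard (C₁ ∪ C₂).ncard
  · exact ih _ hlt hC₁ hC₄ he hf₄ ⟨c, hc₁, hc₄⟩ rfl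
  have heq := eq_of_subset_of_ncard_le hunion₁₄ hge hfin
  have hb₄ : b ∈ C₄ := (heq.ge (Or.inr hb₂)).resolve_left hb₁
  exact ih _ (ncard_lt_ncard (hunion₃₄.trans_ssubset (sdiff_singleton_ssubset.2 (.inl ha₁))) hfin)
    hC₃ hC₄ he₃ hf₄ ⟨b, hb₃, hb₄⟩ rfl

/-- A separator of a matroid: a set `B` that no circuit crosses, so that the matroid is the direct
sum of its restrictions to `B` and to the complement of `B`. -/
def IsSeparator (M : Matroid β) (B : Set β) : Prop :=
  ∀ C, M.IsCircuit C → C ⊆ B ∨ Disjoint C B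

lemma IsSeparator.compl (hB : IsSeparator M B) : IsSeparator M (M.E \ B) := fun C hC =>
  (hB C hC).symm.imp (fun hdisj => subset_sdiff.2 ⟨hC.subset_ground, hdisj⟩)
    fun hCB => disjoint_sdiff_right.mono_left hCB

lemma IsSeparator.indep_union (hB : IsSeparator M B) (hI : M.Indep I) (hJ : M.Indep J)
    (hIB : I ⊆ B) (hJB : Disjoint J B) : M.Indep (I ∪ J) := by
  rw [M.indep_iff_forall_subset_not_isCircuit (union_subset hI.subset_ground hJ.subset_ground)]
  intro C hCIJ hC
  obtain hCB | hCB := hB C hC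
  · exact hC.not_indep <| hI.subset fun g hg =>
      (hCIJ hg).resolve_right fun hgJ => hJB.notMem_of_mem_left hgJ (hCB hg)
  · exact hC.not_indep <| hJ.subset fun g hg =>
      (hCIJ hg).resolve_left fun hgI => hCB.notMem_of_mem_left hg (hIB hgI)

lemma IsSeparator.eRk_inter_add_eRk_sdiff_le (hB : IsSeparator M B) (X : Set β) :
    M.eRk (X ∩ B) + M.eRk (X \ B) ≤ M.eRk X := by
  obtain ⟨I, hIX, hI, hIcard⟩ := Matroid.le_eRk_iff.1 (le_refl (M.eRk (X ∩ B)))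
  obtain ⟨J, hJX, hJ, hJcard⟩ := Matroid.le_eRk_iff.1 (le_refl (M.eRk (X \ B)))
  have hJB : Disjoint J B := disjoint_sdiff_left.mono_left hJX
  have hIB : I ⊆ B := hIX.trans inter_subset_right
  rw [← hIcard, ← hJcard, ← encard_union_eq (hJB.symm.mono_left hIB)]
  exact (hB.indep_union hI hJ hIB hJB).encard_le_eRk_of_subset
    (union_subset (hIX.trans inter_subset_left) (hJX.trans sdiff_subset))

lemma isSeparator_setOf_exists_isCircuit [M.Finitary] (e : β) :
    IsSeparator M {g | ∃ C, M.IsCircuit C ∧ e ∈ C ∧ g ∈ C} := by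
  intro C hC
  refine or_iff_not_imp_right.2 fun hmeet g hg => ?_
  obtain ⟨h, hhC, C', hC', heC', hhC'⟩ := not_disjoint_iff.1 hmeet
  exact exists_isCircuit_mem_mem_of_inter_nonempty hC' hC heC' hg ⟨h, hhC', hhC⟩

lemma isConnected_of_forall_isSeparator [M.Finitary] (hne : M.E.Nonempty)
    (hloop : ∀ e, ¬ M.IsLoop e) (hcoloop : ∀ e, ¬ M.IsColoop e)
    (hsep : ∀ B ⊆ M.E, IsSeparator M B → B.Nonempty → B = M.E) : M.IsConnected := by
  refine ⟨hne, hloop, hcoloop, fun e he f hf _ => ?_⟩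
  have hground : {g | ∃ C, M.IsCircuit C ∧ e ∈ C ∧ g ∈ C} = M.E := by
    refine hsep _ (fun g ⟨C, hC, _, hg⟩ => hC.subset_ground hg)
      (isSeparator_setOf_exists_isCircuit e) ⟨e, ?_⟩
    obtain ⟨C, hC, heC⟩ := Matroid.exists_mem_isCircuit_of_not_isColoop he (hcoloop e)
    exact ⟨C, hC, heC, heC⟩
  exact hground.ge hf

lemma eRk_compl_add_one_of_isCocircuit [M.RankFinite] (hK : M.IsCocircuit K) :
    M.eRk (M.E \ K) + 1 = M.eRank := by
  obtain ⟨e, he⟩ := hK.nonempty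
  have hKE := hK.subset_ground
  rw [Matroid.isCocircuit_iff_minimal_compl_nonspanning] at hK
  have hlt : M.eRk (M.E \ K) < M.eRank := by
    simpa [Matroid.spanning_iff_eRk_le sdiff_subset] using hK.prop
  have hspan : M.Spanning (M.E \ (K \ {e})) := by
    simpa using hK.not_prop_of_ssubset (sdiff_singleton_ssubset.2 he)
  have hinsert : M.E \ (K \ {e}) = insert e (M.E \ K) := by
    rw [sdiff_sdiff_right, inter_eq_self_of_subset_right (singleton_subset_iff.2 (hKE he)),
      union_singleton]
  refine le_antisymm (Order.add_one_le_of_lt hlt) ?_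
  calc M.eRank ≤ M.eRk (M.E \ (K \ {e})) := (Matroid.spanning_iff_eRk_le sdiff_subset).1 hspan
    _ ≤ M.eRk (M.E \ K) + 1 := hinsert ▸ M.eRk_insert_le_add_one e _

lemma isCocircuit_of_eRk_compl_add_one [M.RankFinite] (hKE : K ⊆ M.E)
    (hrank : M.eRk (M.E \ K) + 1 = M.eRank) (hflat : ∀ e ∈ K, e ∉ M.closure (M.E \ K)) :
    M.IsCocircuit K := by
  have hlt : M.eRk (M.E \ K) < M.eRank := by
    refine hrank ▸ (ENat.lt_add_one_iff ?_).2 le_rfl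
    exact ne_top_of_le_ne_top (M.eRank_ne_top_iff.2 inferInstance) (M.eRk_le_eRank _)
  rw [Matroid.isCocircuit_iff_minimal_compl_nonspanning, minimal_iff_forall_ssubset]
  refine ⟨?_, fun Y hY => not_not.2 ?_⟩
  · rwa [Matroid.spanning_iff_eRk_le sdiff_subset, not_le]
  · obtain ⟨e, heK, heY⟩ := exists_of_ssubset hY
    rw [Matroid.spanning_iff_eRk_le sdiff_subset, ← hrank,
      ← Matroid.eRk_insert_eq_add_one ⟨hKE heK, hflat e heK⟩]
    exact M.eRk_mono (insert_subset ⟨hKE heK, heY⟩ (sdiff_subset_sdiff_right hY.subset))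

lemma encard_le_eRank_dual_iff [M.Finite] (hX : X ⊆ M.E) :
    X.encard ≤ M✶.eRank ↔ M.eRank ≤ (M.E \ X).encard := by
  have hdual := M.eRank_add_eRank_dual
  rw [← encard_sdiff_add_encard_of_subset hX] at hdual
  have hXfin : X.encard ≠ ⊤ := encard_ne_top_iff.2 (M.ground_finite.subset hX)
  have hrank : M.eRank ≠ ⊤ := M.eRank_ne_top_iff.2 inferInstance
  generalize X.encard = x at *
  generalize M.eRank = r at *
  generalize M✶.eRank = s at *
  generalize (M.E \ X).encard = y at *
  enat_to_nat <;> norm_cast at *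
  omega

end Matroid

section Excess

variable {α β : Type*} {G H : Graph α β} {A C X Y : Set β} {k : ℕ}

/-- The excess `Δ(G⟨X⟩)` of the subgraph spanned by an edge set `X`, as a function of `X`; see
`excess_edgeInduce` for the agreement with `Graph.excess`. -/
noncomputable def edgeExcess (G : Graph α β) (X : Set β) : ℤ :=
  (X.ncard : ℤ) - ((G.endSet X).ncard : ℤ)

lemma excess_edgeInduce (hX : X ⊆ G.edgeSet) : (G.edgeInduce X).excess = edgeExcess G X := by
  rw [excess, edgeSet_edgeInduce hX, vertexSet_edgeInduce, edgeExcess]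

lemma endSet_empty : G.endSet ∅ = ∅ := by
  simp [endSet]

lemma edgeExcess_empty : edgeExcess G ∅ = 0 := by
  simp [edgeExcess, endSet_empty]

lemma nonempty_of_natCast_le_edgeExcess (hk : 1 ≤ k) (hX : (k : ℤ) ≤ edgeExcess G X) :
    X.Nonempty := by
  rw [nonempty_iff_ne_empty]
  rintro rfl
  rw [edgeExcess_empty] at hX
  omega

lemma natCast_le_edgeExcess_iff (hX : X.Finite) :
    (k : ℤ) ≤ edgeExcess G X ↔ (G.endSet X).encard + k ≤ X.encard := by
  rw [edgeExcess, le_sub_iff_add_le', ← hX.cast_ncard_eq, ← (endSet_finite hX).cast_ncard_eq]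
  norm_cast

lemma edgeExcess_of_mem_kCircuits (hC : C ∈ G.kCircuits k) : edgeExcess G C = k :=
  excess_edgeInduce hC.1 ▸ hC.2.1

lemma edgeExcess_add_le (hX : X.Finite) (hY : Y.Finite) :
    edgeExcess G X + edgeExcess G Y ≤ edgeExcess G (X ∪ Y) + edgeExcess G (X ∩ Y) := by
  have hedges := ncard_union_add_ncard_inter X Y hX hY
  have hends := ncard_union_add_ncard_inter (G.endSet X) (G.endSet Y) (endSet_finite hX)
    (endSet_finite hY)
  have hinter : (G.endSet (X ∩ Y)).ncard ≤ (G.endSet X ∩ G.endSet Y).ncard :=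
    ncard_le_ncard
      (subset_inter (endSet_mono inter_subset_left) (endSet_mono inter_subset_right))
      ((endSet_finite hX).inter_of_left _)
  rw [edgeExcess, edgeExcess, edgeExcess, edgeExcess, endSet_union]
  omega

lemma two_le_degree_of_isCactiGraph (hH : H.IsCactiGraph) (hE : H.edgeSet.Finite) {v : α}
    (hv : v ∈ H.vertexSet) : 2 ≤ H.degree v := by
  have hpos : 0 < (H.incidenceSet v).ncard :=
    (ncard_pos (hE.subset (H.incidenceSet_subset_edgeSet v))).2 <|
      nonempty_iff_ne_empty.2 fun h => hH.not_isolated v ⟨hv, h⟩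
  have hone : H.degree v ≠ 1 := fun h => hH.not_leaf v ⟨hv, h⟩
  rw [degree] at hone ⊢
  omega

lemma excess_nonneg_of_two_le_degree (hV : H.vertexSet.Finite) (hE : H.edgeSet.Finite)
    (hdeg : ∀ v ∈ H.vertexSet, 2 ≤ H.degree v) : 0 ≤ H.excess := by
  have hlower : hV.toFinset.card * 2 ≤ ∑ v ∈ hV.toFinset, H.degree v :=
    Finset.card_nsmul_le_sum _ _ _ fun v hv => hdeg v (hV.mem_toFinset.1 hv)
  have hupper : ∑ e ∈ hE.toFinset, H.endCount hV.toFinset e ≤ hE.toFinset.card * 2 := by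
    refine Finset.sum_le_card_nsmul _ _ _ fun e he => ?_
    obtain ⟨x, y, hxy⟩ := exists_isLink_of_mem_edgeSet (hE.mem_toFinset.1 he)
    rw [endCount_eq hxy]
    split_ifs <;> omega
  rw [sum_degree hE] at hlower
  rw [excess, ncard_eq_toFinset_card _ hV, ncard_eq_toFinset_card _ hE]
  omega

lemma edgeExcess_lt_of_ssubset (hE : G.edgeSet.Finite) (hA : A ⊆ G.edgeSet)
    (hcacti : (G.edgeInduce A).IsCactiGraph) (hY : Y ⊂ A) : edgeExcess G Y < edgeExcess G A := by
  have hHE : (G.edgeInduce A).edgeSet.Finite :=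
    (hE.subset hA).subset (edgeSet_edgeInduce hA).subset
  obtain ⟨k, hk⟩ := Int.eq_ofNat_of_zero_le <|
    excess_nonneg_of_two_le_degree (endSet_finite (hE.subset hA)) hHE
      fun v => two_le_degree_of_isCactiGraph hcacti hHE
  have hsparse := sparse_of_ssubset_kCircuit hE ⟨hA, hk, hcacti⟩ hY
  rw [← excess_edgeInduce hA, hk, edgeExcess]
  omega

lemma isCactiGraph_edgeInduce_iff (hE : G.edgeSet.Finite) (hA : A ⊆ G.edgeSet) :
    (G.edgeInduce A).IsCactiGraph ↔ ∀ Y ⊂ A, edgeExcess G Y < edgeExcess G A := by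
  refine ⟨fun hcacti Y => edgeExcess_lt_of_ssubset hE hA hcacti, fun hmax => ?_⟩
  obtain rfl | hne := A.eq_empty_or_nonempty
  · have hV : ∀ v, v ∉ (G.edgeInduce ∅).vertexSet := by simp [vertexSet_edgeInduce, endSet_empty]
    exact ⟨fun v hv => hV v hv.1, fun v hv => hV v hv.1, fun v hv => absurd hv (hV v)⟩
  have hpos : 0 < edgeExcess G A := edgeExcess_empty (G := G) ▸ hmax ∅ hne.empty_ssubset
  obtain ⟨k, hk⟩ := Int.eq_ofNat_of_zero_le hpos.le
  obtain ⟨C, hC, hCA⟩ : ∃ C ∈ G.kCircuits k, C ⊆ A :=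
    exists_kCircuit_subset hE (by omega) hA (by rw [edgeExcess] at hk; omega)
  obtain rfl | hss := hCA.eq_or_ssubset
  · exact hC.2.2
  · have := hmax C hss
    rw [edgeExcess_of_mem_kCircuits hC] at this
    omega

lemma isCactiGraph_edgeInduce_of_forall_mem (hE : G.edgeSet.Finite) (hA : A ⊆ G.edgeSet)
    (hcover : ∀ e ∈ A, ∃ C ⊆ A, e ∈ C ∧ (G.edgeInduce C).IsCactiGraph) :
    (G.edgeInduce A).IsCactiGraph := by
  rw [isCactiGraph_edgeInduce_iff hE hA]
  intro Y hY
  induction hn : (A \ Y).ncard using Nat.strong_induction_on generalizing Y with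
  | _ n ih =>
  obtain ⟨e, heA, heY⟩ := exists_of_ssubset hY
  obtain ⟨C, hCA, heC, hcacti⟩ := hcover e heA
  have hfin : ∀ {Z}, Z ⊆ A → Z.Finite := fun hZ => hE.subset (hZ.trans hA)
  have hinter : edgeExcess G (C ∩ Y) < edgeExcess G C :=
    edgeExcess_lt_of_ssubset hE (hCA.trans hA) hcacti
      ⟨inter_subset_left, fun h => heY (h heC).2⟩
  have hsuper := edgeExcess_add_le (G := G) (hfin hCA) (hfin hY.subset)
  obtain heq | hss := (union_subset hCA hY.subset).eq_or_ssubset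
  · rw [heq] at hsuper
    omega
  · have hdecr : (A \ (C ∪ Y)).ncard < n :=
      hn ▸ ncard_lt_ncard ⟨sdiff_subset_sdiff_right subset_union_right,
        fun h => (h ⟨heA, heY⟩).2 (.inl heC)⟩ (hfin sdiff_subset)
    have := ih _ hdecr _ hss rfl
    omega

lemma edgeExcess_lt_of_subset_sdiff_singleton (hE : G.edgeSet.Finite) (hA : A ⊆ G.edgeSet)
    (hC : C ∈ G.kCircuits k) (hCA : C ⊆ A) {e : β} (he : e ∈ C)
    (hmax : ∀ Y ⊆ A, edgeExcess G Y < k + 1) (hX : X ⊆ A \ {e}) : edgeExcess G X < k := by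
  -- By supermodularity the sets of maximal excess are closed under intersection, so each of them
  -- contains `C`, which is a minimal one.
  have hXA := hX.trans sdiff_subset
  have hunion := hmax (X ∪ C) (union_subset hXA hCA)
  have hinter : edgeExcess G (X ∩ C) < edgeExcess G C :=
    edgeExcess_lt_of_ssubset hE hC.1 hC.2.2 ⟨inter_subset_right, fun h => (hX (h he).1).2 rfl⟩
  have hsuper := edgeExcess_add_le (G := G) (hE.subset (hXA.trans hA)) (hE.subset hC.1)
  omega

end Excess

section Rank

variable {α β : Type*} {G : Graph α β} {A B X : Set β} {k : ℕ} {hE : G.edgeSet.Finite}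
  {hk : 1 ≤ k} {e : β}

instance : (G.kCircularMatroid hE k hk).Finite := ⟨hE⟩

lemma indep_iff_forall_edgeExcess_lt : (G.kCircularMatroid hE k hk).Indep X ↔
    X ⊆ G.edgeSet ∧ ∀ Y ⊆ X, edgeExcess G Y < k := by
  rw [kCircularMatroid_indep_iff]
  refine and_congr_right fun hX => (forall_not_kCircuit_iff hE hk hX).trans ?_
  refine forall₂_congr fun Y _ => ?_
  rw [edgeExcess]
  omega

lemma eRk_add_one_le (hX : X ⊆ G.edgeSet) :
    (G.kCircularMatroid hE k hk).eRk X + 1 ≤ (G.endSet X).encard + k := by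
  obtain ⟨I, hI⟩ := (G.kCircularMatroid hE k hk).exists_isBasis X hX
  have hXfin := hE.subset hX
  have hIexcess := (indep_iff_forall_edgeExcess_lt.1 hI.indep).2 I subset_rfl
  have hends := ncard_le_ncard (endSet_mono (G := G) hI.subset) (endSet_finite hXfin)
  rw [edgeExcess] at hIexcess
  rw [← hI.encard_eq_eRk, ← (hXfin.subset hI.subset).cast_ncard_eq,
    ← (endSet_finite hXfin).cast_ncard_eq]
  norm_cast
  omega

lemma exists_indep_ncard_sdiff_le (hA : A ⊆ G.edgeSet) (m : ℕ)
    (hexcess : ∀ Y ⊆ A, edgeExcess G Y < k + m) :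
    ∃ I ⊆ A, (G.kCircularMatroid hE k hk).Indep I ∧ (A \ I).ncard ≤ m := by
  induction m generalizing A with
  | zero => exact ⟨A, subset_rfl, indep_iff_forall_edgeExcess_lt.2 ⟨hA, by simpa using hexcess⟩,
      by simp⟩
  | succ m ih =>
  by_cases hlt : ∀ Y ⊆ A, edgeExcess G Y < k + m
  · obtain ⟨I, hIA, hI, hcard⟩ := ih hA hlt
    exact ⟨I, hIA, hI, hcard.trans m.le_succ⟩
  push Not at hlt
  obtain ⟨Y, hYA, hY⟩ := hlt
  obtain ⟨D, hD, hDY⟩ : ∃ D ∈ G.kCircuits (k + m), D ⊆ Y :=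
    exists_kCircuit_subset hE (by omega) (hYA.trans hA) (by rw [edgeExcess] at hY; omega)
  have hDexcess := edgeExcess_of_mem_kCircuits hD
  obtain ⟨e, heD⟩ : D.Nonempty :=
    nonempty_of_natCast_le_edgeExcess (k := k + m) (by omega) hDexcess.ge
  obtain ⟨I, hIA, hI, hcard⟩ := ih (sdiff_subset.trans hA) fun Z =>
    edgeExcess_lt_of_subset_sdiff_singleton hE hA hD (hDY.trans hYA) heD
      fun W hW => (hexcess W hW).trans_eq (by push_cast; ring)
  refine ⟨I, hIA.trans sdiff_subset, hI, ?_⟩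
  have heI : e ∈ A \ I := ⟨hYA (hDY heD), fun h => (hIA h).2 rfl⟩
  rw [← ncard_sdiff_singleton_add_one heI (hE.subset (sdiff_subset.trans hA)), sdiff_sdiff_comm]
  omega

lemma encard_endSet_add_le_eRk_sdiff_singleton (hA : A ⊆ G.edgeSet)
    (hcacti : (G.edgeInduce A).IsCactiGraph) (hAk : (k : ℤ) ≤ edgeExcess G A) (he : e ∈ A) :
    (G.endSet A).encard + k ≤ (G.kCircularMatroid hE k hk).eRk (A \ {e}) + 1 := by
  have hAfin := hE.subset hA
  obtain ⟨m, hm⟩ := Int.le.dest hAk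
  obtain ⟨I, hIA, hI, hcard⟩ :=
    exists_indep_ncard_sdiff_le (hE := hE) (hk := hk) (A := A \ {e}) (sdiff_subset.trans hA) m
      fun Y hY => hm ▸ edgeExcess_lt_of_ssubset hE hA hcacti
        (hY.trans_ssubset (sdiff_singleton_ssubset.2 he))
  have hsplit := ncard_sdiff_add_ncard_of_subset hIA (hAfin.subset sdiff_subset)
  have hAe := ncard_sdiff_singleton_add_one he hAfin
  rw [edgeExcess] at hm
  refine le_trans ?_ (add_le_add_left (hI.encard_le_eRk_of_subset hIA) 1)
  rw [← (endSet_finite hAfin).cast_ncard_eq,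
    ← (hAfin.subset (hIA.trans sdiff_subset)).cast_ncard_eq]
  norm_cast
  omega

lemma eRk_add_one_of_isCactiGraph (hA : A ⊆ G.edgeSet) (hcacti : (G.edgeInduce A).IsCactiGraph)
    (hAk : (k : ℤ) ≤ edgeExcess G A) :
    (G.kCircularMatroid hE k hk).eRk A + 1 = (G.endSet A).encard + k := by
  obtain ⟨e, he⟩ := nonempty_of_natCast_le_edgeExcess hk hAk
  refine (eRk_add_one_le hA).antisymm ?_
  refine (encard_endSet_add_le_eRk_sdiff_singleton (hE := hE) (hk := hk) hA hcacti hAk he).trans ?_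
  gcongr
  exact Matroid.eRk_mono _ sdiff_subset

lemma mem_closure_sdiff_singleton_of_isCactiGraph (hA : A ⊆ G.edgeSet)
    (hcacti : (G.edgeInduce A).IsCactiGraph) (hAk : (k : ℤ) ≤ edgeExcess G A) (he : e ∈ A) :
    e ∈ (G.kCircularMatroid hE k hk).closure (A \ {e}) := by
  by_contra hmem
  have hrank := Matroid.eRk_insert_eq_add_one (M := G.kCircularMatroid hE k hk) ⟨hA he, hmem⟩
  rw [insert_sdiff_singleton, insert_eq_of_mem he] at hrank
  have hle : (G.kCircularMatroid hE k hk).eRk A + 1 ≤ (G.kCircularMatroid hE k hk).eRk A :=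
    calc _ = (G.endSet A).encard + k := eRk_add_one_of_isCactiGraph hA hcacti hAk
      _ ≤ _ := hrank ▸ encard_endSet_add_le_eRk_sdiff_singleton hA hcacti hAk he
  exact hle.not_gt <| (ENat.lt_add_one_iff <| Matroid.eRk_ne_top_iff.2 <|
    Matroid.isRkFinite_of_finite _ (hE.subset hA)).2 le_rfl

lemma eq_one_and_disjoint_of_eRk_add_eRk_le_eRk_union (hA : A ⊆ G.edgeSet) (hB : B ⊆ G.edgeSet)
    (hAcacti : (G.edgeInduce A).IsCactiGraph) (hBcacti : (G.edgeInduce B).IsCactiGraph)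
    (hAk : (k : ℤ) ≤ edgeExcess G A) (hBk : (k : ℤ) ≤ edgeExcess G B)
    (hrank : (G.kCircularMatroid hE k hk).eRk A + (G.kCircularMatroid hE k hk).eRk B ≤
      (G.kCircularMatroid hE k hk).eRk (A ∪ B)) :
    k = 1 ∧ Disjoint (G.endSet A) (G.endSet B) := by
  have hA_rank := eRk_add_one_of_isCactiGraph (hE := hE) (hk := hk) hA hAcacti hAk
  have hB_rank := eRk_add_one_of_isCactiGraph (hE := hE) (hk := hk) hB hBcacti hBk
  have hunion := eRk_add_one_le (hE := hE) (hk := hk) (union_subset hA hB)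
  rw [endSet_union] at hunion
  have hends := encard_union_add_encard_inter (G.endSet A) (G.endSet B)
  have hAfin := encard_ne_top_iff.2 (endSet_finite (G := G) (hE.subset hA))
  have hBfin := encard_ne_top_iff.2 (endSet_finite (G := G) (hE.subset hB))
  rw [disjoint_iff_inter_eq_empty, ← encard_eq_zero]
  generalize (G.kCircularMatroid hE k hk).eRk (A ∪ B) = rAB at *
  generalize (G.kCircularMatroid hE k hk).eRk A = rA at *
  generalize (G.kCircularMatroid hE k hk).eRk B = rB at *
  generalize (G.endSet A ∪ G.endSet B).encard = u at *
  generalize (G.endSet A ∩ G.endSet B).encard = i at *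
  generalize (G.endSet A).encard = a at *
  generalize (G.endSet B).encard = b at *
  enat_to_nat <;> norm_cast at *
  omega

end Rank

section Connectivity

variable {α β : Type*} {G : Graph α β} {A B C : Set β} {k : ℕ} {hE : G.edgeSet.Finite} {hk : 1 ≤ k}

lemma endSet_nonempty (hA : A ⊆ G.edgeSet) (hne : A.Nonempty) : (G.endSet A).Nonempty := by
  obtain ⟨e, he⟩ := hne
  obtain ⟨x, y, hxy⟩ := exists_isLink_of_mem_edgeSet (hA he)
  exact ⟨x, e, he, hxy.inc_left⟩

lemma endSet_inter_sdiff_nonempty_of_isConnected (hA : A ⊆ G.edgeSet)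
    (hconn : (G.edgeInduce A).IsConnected) (hBA : B ⊆ A) (hB : B.Nonempty)
    (hAB : (A \ B).Nonempty) : (G.endSet B ∩ G.endSet (A \ B)).Nonempty := by
  obtain ⟨x, hx⟩ := endSet_nonempty (hBA.trans hA) hB
  obtain ⟨y, hy⟩ := endSet_nonempty (sdiff_subset.trans hA) hAB
  by_contra hempty
  have hreach : ∀ z, Relation.ReflTransGen (G.edgeInduce A).Adj x z → z ∈ G.endSet B := by
    intro z hz
    induction hz with
    | refl => exact hx
    | @tail b c _ hbc hb =>
      obtain ⟨e, he⟩ := hbc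
      obtain ⟨heA, he⟩ := edgeInduce_isLink.1 he
      by_cases heB : e ∈ B
      · exact ⟨e, heB, he.inc_right⟩
      · exact absurd ⟨b, hb, e, ⟨heA, heB⟩, he.inc_left⟩ hempty
  have hyB : y ∈ G.endSet B :=
    hreach y (hconn.2 x (endSet_mono hBA hx) y (endSet_mono sdiff_subset hy))
  exact hempty ⟨y, hyB, hy⟩

lemma edgeInduce_isConnected_of_forall_inter_nonempty (hA : A ⊆ G.edgeSet) (hne : A.Nonempty)
    (hinter : ∀ B ⊆ A, B.Nonempty → (A \ B).Nonempty → (G.endSet B ∩ G.endSet (A \ B)).Nonempty) :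
    (G.edgeInduce A).IsConnected := by
  refine ⟨endSet_nonempty hA hne, fun x hx y hy => ?_⟩
  by_contra hxy
  set R := {z | Relation.ReflTransGen (G.edgeInduce A).Adj x z}
  set B := {e ∈ A | ∃ z ∈ R, G.Inc e z}
  have hBR : G.endSet B ⊆ R := by
    rintro v ⟨e, ⟨heA, z, hz, w, hzw⟩, hev⟩
    obtain rfl | rfl := hev.eq_or_eq_of_isLink hzw
    · exact hz
    · exact hz.tail ⟨e, edgeInduce_isLink.2 ⟨heA, hzw⟩⟩
  obtain ⟨e, heA, hex⟩ := hx
  obtain ⟨f, hfA, hfy⟩ := hy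
  have heB : e ∈ B := ⟨heA, x, .refl, hex⟩
  have hfB : f ∉ B := fun hfB => hxy (hBR ⟨f, hfB, hfy⟩)
  obtain ⟨v, hvB, g, ⟨hgA, hgB⟩, hgv⟩ := hinter B (sep_subset _ _) ⟨e, heB⟩ ⟨f, hfA, hfB⟩
  exact hgB ⟨hgA, v, hBR hvB, hgv⟩

lemma endSet_inter_sdiff_nonempty_of_mem_kCircuits_one (hE : G.edgeSet.Finite)
    (hC : C ∈ G.kCircuits 1) (hCB : (C ∩ B).Nonempty) (hCB' : (C \ B).Nonempty) :
    (G.endSet (C ∩ B) ∩ G.endSet (C \ B)).Nonempty := by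
  have hCfin := hE.subset hC.1
  obtain ⟨e, heC, heB⟩ := hCB
  obtain ⟨f, hfC, hfB⟩ := hCB'
  have hin := sparse_of_ssubset_kCircuit hE hC
    (show C ∩ B ⊂ C from ⟨inter_subset_left, fun h => hfB (h hfC).2⟩)
  have hout := sparse_of_ssubset_kCircuit hE hC
    (show C \ B ⊂ C from ⟨sdiff_subset, fun h => (h heC).2 heB⟩)
  have hcard := ncard_of_mem_kCircuits hC
  have hedges := ncard_inter_add_ncard_sdiff_eq_ncard C B hCfin
  have hends := ncard_union_add_ncard_inter (G.endSet (C ∩ B)) (G.endSet (C \ B))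
    (endSet_finite (hCfin.subset inter_subset_left)) (endSet_finite (hCfin.subset sdiff_subset))
  rw [← endSet_union, inter_union_sdiff] at hends
  refine nonempty_of_ncard_ne_zero ?_
  omega

lemma not_isLoop_kCircularMatroid (e : β) : ¬ (G.kCircularMatroid hE k hk).IsLoop e := by
  rw [← Matroid.singleton_isCircuit, kCircularMatroid_isCircuit_iff]
  intro hC
  have hcard := ncard_of_mem_kCircuits hC
  have hpos := (ncard_pos (endSet_finite (finite_singleton e))).2
    (endSet_nonempty hC.1 (singleton_nonempty e))
  rw [ncard_singleton] at hcard
  omega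

lemma isCactiGraph_and_le_edgeExcess_of_forall_mem_isCircuit (hA : A ⊆ G.edgeSet)
    (hne : A.Nonempty)
    (hcover : ∀ e ∈ A, ∃ C ⊆ A, (G.kCircularMatroid hE k hk).IsCircuit C ∧ e ∈ C) :
    (G.edgeInduce A).IsCactiGraph ∧ (k : ℤ) ≤ edgeExcess G A := by
  simp only [kCircularMatroid_isCircuit_iff] at hcover
  have hcacti : (G.edgeInduce A).IsCactiGraph :=
    isCactiGraph_edgeInduce_of_forall_mem hE hA fun e he =>
      let ⟨C, hCA, hC, heC⟩ := hcover e he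
      ⟨C, hCA, heC, hC.2.2⟩
  obtain ⟨e, he⟩ := hne
  obtain ⟨C, hCA, hC, -⟩ := hcover e he
  refine ⟨hcacti, edgeExcess_of_mem_kCircuits hC ▸ ?_⟩
  obtain rfl | hss := hCA.eq_or_ssubset
  · exact le_rfl
  · exact (edgeExcess_lt_of_ssubset hE hA hcacti hss).le

lemma exists_isCircuit_mem_of_not_isColoop_restrict (hA : A ⊆ G.edgeSet)
    (hcoloop : ∀ e, ¬ ((G.kCircularMatroid hE k hk) ↾ A).IsColoop e) {e : β} (he : e ∈ A) :
    ∃ C ⊆ A, (G.kCircularMatroid hE k hk).IsCircuit C ∧ e ∈ C := by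
  obtain ⟨C, hC, heC⟩ := Matroid.exists_mem_isCircuit_of_not_isColoop he (hcoloop e)
  exact ⟨C, hC.subset_ground, ((Matroid.restrict_isCircuit_iff hA).1 hC).1, heC⟩

lemma isCactiGraph_and_le_edgeExcess_of_isSeparator (hA : A ⊆ G.edgeSet)
    (hcoloop : ∀ e, ¬ ((G.kCircularMatroid hE k hk) ↾ A).IsColoop e)
    (hsep : IsSeparator ((G.kCircularMatroid hE k hk) ↾ A) B) (hBA : B ⊆ A) (hB : B.Nonempty) :
    (G.edgeInduce B).IsCactiGraph ∧ (k : ℤ) ≤ edgeExcess G B := by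
  refine isCactiGraph_and_le_edgeExcess_of_forall_mem_isCircuit (hE := hE) (hk := hk)
    (hBA.trans hA) hB fun e he => ?_
  obtain ⟨C, hCA, hC, heC⟩ := exists_isCircuit_mem_of_not_isColoop_restrict hA hcoloop (hBA he)
  have hCB := hsep C ((Matroid.restrict_isCircuit_iff hA).2 ⟨hC, hCA⟩)
  exact ⟨C, hCB.resolve_right fun hdisj => hdisj.notMem_of_mem_left heC he, hC, heC⟩

lemma edgeInduce_isConnected_of_restrict_isConnected {hk : 1 ≤ 1} (hA : A ⊆ G.edgeSet)
    (hconn : ((G.kCircularMatroid hE 1 hk) ↾ A).IsConnected) : (G.edgeInduce A).IsConnected := by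
  refine edgeInduce_isConnected_of_forall_inter_nonempty hA hconn.nonempty ?_
  rintro B hBA ⟨e, heB⟩ ⟨f, hfA, hfB⟩
  obtain ⟨C, hC, heC, hfC⟩ :=
    hconn.exists_isCircuit e (hBA heB) f hfA fun hef => hfB (hef ▸ heB)
  obtain ⟨hC, hCA⟩ := (Matroid.restrict_isCircuit_iff hA).1 hC
  rw [kCircularMatroid_isCircuit_iff] at hC
  refine (endSet_inter_sdiff_nonempty_of_mem_kCircuits_one hE hC
    ⟨e, heC, heB⟩ ⟨f, hfC, hfB⟩).mono ?_
  exact inter_subset_inter (endSet_mono inter_subset_right)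
    (endSet_mono (sdiff_subset_sdiff_left hCA))

lemma eq_of_isSeparator_restrict (hA : A ⊆ G.edgeSet)
    (hconn : k = 1 → (G.edgeInduce A).IsConnected)
    (hcoloop : ∀ e, ¬ ((G.kCircularMatroid hE k hk) ↾ A).IsColoop e)
    (hsep : IsSeparator ((G.kCircularMatroid hE k hk) ↾ A) B) (hBA : B ⊆ A) (hB : B.Nonempty) :
    B = A := by
  by_contra hne
  have hAB : (A \ B).Nonempty := sdiff_nonempty.2 fun h => hne (hBA.antisymm h)
  have hABE : A \ B ⊆ G.edgeSet := sdiff_subset.trans hA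
  obtain ⟨hBcacti, hBk⟩ :=
    isCactiGraph_and_le_edgeExcess_of_isSeparator hA hcoloop hsep hBA hB
  obtain ⟨hABcacti, hABk⟩ :=
    isCactiGraph_and_le_edgeExcess_of_isSeparator hA hcoloop hsep.compl sdiff_subset hAB
  have hrank := hsep.eRk_inter_add_eRk_sdiff_le A
  rw [inter_eq_self_of_subset_right hBA, Matroid.restrict_eRk_eq _ hBA,
    Matroid.restrict_eRk_eq _ sdiff_subset, Matroid.restrict_eRk_eq _ subset_rfl] at hrank
  obtain ⟨rfl, hdisj⟩ := eq_one_and_disjoint_of_eRk_add_eRk_le_eRk_union (hE := hE) (hk := hk)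
    (hBA.trans hA) hABE hBcacti hABcacti hBk hABk (by rwa [union_sdiff_cancel hBA])
  exact (endSet_inter_sdiff_nonempty_of_isConnected hA (hconn rfl) hBA hB hAB).ne_empty
    hdisj.inter_eq

lemma restrict_isConnected_iff (hA : A ⊆ G.edgeSet) :
    ((G.kCircularMatroid hE k hk) ↾ A).IsConnected ↔
      (G.edgeInduce A).IsCactiGraph ∧ (k : ℤ) ≤ edgeExcess G A ∧
        (k = 1 → (G.edgeInduce A).IsConnected) := by
  constructor
  · intro hconn
    obtain ⟨hcacti, hAk⟩ := isCactiGraph_and_le_edgeExcess_of_forall_mem_isCircuit hA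
      hconn.nonempty fun e => exists_isCircuit_mem_of_not_isColoop_restrict hA hconn.not_isColoop
    refine ⟨hcacti, hAk, ?_⟩
    rintro rfl
    exact edgeInduce_isConnected_of_restrict_isConnected hA hconn
  · rintro ⟨hcacti, hAk, hconn⟩
    have hne : A.Nonempty := nonempty_of_natCast_le_edgeExcess hk hAk
    have hloop : ∀ e, ¬ ((G.kCircularMatroid hE k hk) ↾ A).IsLoop e := fun e he =>
      not_isLoop_kCircularMatroid e
        ((Matroid.restrict_isLoop_iff.1 he).2.resolve_right fun h => h (hA he.mem_ground))
    have hcoloop : ∀ e, ¬ ((G.kCircularMatroid hE k hk) ↾ A).IsColoop e := fun e he =>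
      ((Matroid.restrict_isColoop_iff hA).1 he).1
        (mem_closure_sdiff_singleton_of_isCactiGraph hA hcacti hAk he.mem_ground)
    exact isConnected_of_forall_isSeparator hne hloop hcoloop fun B hBA hsep =>
      eq_of_isSeparator_restrict hA hconn hcoloop hsep hBA

end Connectivity

section VertexStar

variable {α β : Type*} {G : Graph α β} {K X : Set β} {x : α} {k : ℕ} {hE : G.edgeSet.Finite}
  {hk : 1 ≤ k} {e : β}

lemma endSet_subset_vertexSet : G.endSet X ⊆ G.vertexSet := by
  rintro v ⟨e, -, hev⟩
  exact hev.vertex_mem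

lemma endSet_edgeSet (hG : ∀ v, ¬ G.IsIsolated v) : G.endSet G.edgeSet = G.vertexSet := by
  refine endSet_subset_vertexSet.antisymm fun v hv => ?_
  obtain ⟨e, he⟩ := nonempty_iff_ne_empty.2 fun h => hG v ⟨hv, h⟩
  exact ⟨e, he.edge_mem, he⟩

lemma eRank_add_one_of_isConnected (hG : ∀ v, ¬ G.IsIsolated v)
    (hM : (G.kCircularMatroid hE k hk).IsConnected) :
    (G.kCircularMatroid hE k hk).eRank + 1 = G.vertexSet.encard + k := by
  rw [← Matroid.restrict_ground_eq_self (G.kCircularMatroid hE k hk), kCircularMatroid_ground,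
    restrict_isConnected_iff subset_rfl] at hM
  rw [← endSet_edgeSet hG, ← Matroid.eRk_ground, kCircularMatroid_ground]
  exact eRk_add_one_of_isCactiGraph subset_rfl hM.1 hM.2.1

lemma endSet_sdiff_incidenceSet_subset (x : α) :
    G.endSet (G.edgeSet \ G.incidenceSet x) ⊆ G.vertexSet \ {x} := by
  refine subset_sdiff_singleton endSet_subset_vertexSet ?_
  rintro ⟨e, ⟨-, hex⟩, hex'⟩
  exact hex hex'

lemma deleteVerts_singleton_isLink {u v : α} : (G.deleteVerts {x}).IsLink e u v ↔
    e ∈ G.edgeSet \ G.incidenceSet x ∧ G.IsLink e u v := by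
  rw [deleteVerts_isLink]
  constructor
  · rintro ⟨huv, hu, hv⟩
    refine ⟨⟨huv.edge_mem, fun hex => ?_⟩, huv⟩
    exact (Inc.eq_or_eq_of_isLink hex huv).elim (fun h => hu h.symm) fun h => hv h.symm
  · rintro ⟨⟨-, hex⟩, huv⟩
    exact ⟨huv, fun h => hex (h ▸ huv.inc_left), fun h => hex (h ▸ huv.inc_right)⟩

lemma edgeInduce_eq_deleteVerts
    (hends : G.endSet (G.edgeSet \ G.incidenceSet x) = G.vertexSet \ {x}) :
    G.edgeInduce (G.edgeSet \ G.incidenceSet x) = G.deleteVerts {x} :=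
  Graph.ext hends fun _ _ _ => edgeInduce_isLink.trans deleteVerts_singleton_isLink.symm

lemma endSet_sdiff_incidenceSet (hx : ∀ v, ¬ (G.deleteVerts {x}).IsIsolated v) :
    G.endSet (G.edgeSet \ G.incidenceSet x) = G.vertexSet \ {x} := by
  refine (endSet_sdiff_incidenceSet_subset x).antisymm fun v hv => ?_
  obtain ⟨e, u, he⟩ := nonempty_iff_ne_empty.2 fun h => hx v ⟨hv, h⟩
  obtain ⟨heA, he⟩ := deleteVerts_singleton_isLink.1 he
  exact ⟨e, heA, he.inc_left⟩

lemma notMem_closure_sdiff_incidenceSet (he : e ∈ G.incidenceSet x) :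
    e ∉ (G.kCircularMatroid hE k hk).closure (G.edgeSet \ G.incidenceSet x) := by
  intro hmem
  obtain ⟨C, hCE, hC, heC⟩ := (Matroid.mem_closure_iff_exists_isCircuit fun h => h.2 he).1 hmem
  rw [kCircularMatroid_isCircuit_iff] at hC
  have hCfin := hE.subset hC.1
  have hCe : C \ {e} ⊆ G.edgeSet \ G.incidenceSet x := fun g hg => (hCE hg.1).resolve_left hg.2
  have hlose : G.endSet (C \ {e}) ⊂ G.endSet C :=
    ⟨endSet_mono sdiff_subset, fun h =>
      (endSet_sdiff_incidenceSet_subset x (endSet_mono hCe (h ⟨e, heC, he⟩))).2 rfl⟩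
  have hends := ncard_lt_ncard hlose (endSet_finite hCfin)
  have hsparse := sparse_of_ssubset_kCircuit hE hC (sdiff_singleton_ssubset.2 heC)
  have hcard := ncard_of_mem_kCircuits hC
  have hedges := ncard_sdiff_singleton_add_one heC hCfin
  omega

section FullRank

variable (hrank : (G.kCircularMatroid hE k hk).eRank + 1 = G.vertexSet.encard + k)

include hrank

lemma eRank_eq_encard_sdiff_singleton_add (hx : x ∈ G.vertexSet) :
    (G.kCircularMatroid hE k hk).eRank = (G.vertexSet \ {x}).encard + k := by
  rw [← encard_sdiff_singleton_add_one hx, add_right_comm] at hrank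
  exact ENat.add_left_injective_of_ne_top ENat.one_ne_top hrank

lemma not_spanning_sdiff_incidenceSet (hx : x ∈ G.vertexSet) :
    ¬ (G.kCircularMatroid hE k hk).Spanning (G.edgeSet \ G.incidenceSet x) := by
  have hfin : (G.kCircularMatroid hE k hk).eRk (G.edgeSet \ G.incidenceSet x) ≠ ⊤ :=
    Matroid.eRk_ne_top_iff.2 (Matroid.isRkFinite_of_finite _ (hE.subset sdiff_subset))
  refine fun hspan => ((ENat.add_one_le_iff hfin).1 ?_).not_ge hspan.eRk_eq.ge
  calc _ ≤ (G.endSet (G.edgeSet \ G.incidenceSet x)).encard + k := eRk_add_one_le sdiff_subset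
    _ ≤ (G.vertexSet \ {x}).encard + k := by gcongr; exact endSet_sdiff_incidenceSet_subset x
    _ = _ := (eRank_eq_encard_sdiff_singleton_add hrank hx).symm

lemma encard_incidenceSet_le_eRank_dual_iff (hx : x ∈ G.vertexSet)
    (hends : G.endSet (G.edgeSet \ G.incidenceSet x) = G.vertexSet \ {x}) :
    (G.incidenceSet x).encard ≤ (G.kCircularMatroid hE k hk)✶.eRank ↔
      (k : ℤ) ≤ edgeExcess G (G.edgeSet \ G.incidenceSet x) := by
  rw [encard_le_eRank_dual_iff (G.incidenceSet_subset_edgeSet x), kCircularMatroid_ground,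
    natCast_le_edgeExcess_iff (hE.subset sdiff_subset), hends,
    eRank_eq_encard_sdiff_singleton_add hrank hx]

lemma isCocircuit_incidenceSet (hx : x ∈ G.vertexSet)
    (hends : G.endSet (G.edgeSet \ G.incidenceSet x) = G.vertexSet \ {x})
    (hcacti : (G.edgeInduce (G.edgeSet \ G.incidenceSet x)).IsCactiGraph)
    (hexcess : (k : ℤ) ≤ edgeExcess G (G.edgeSet \ G.incidenceSet x)) :
    (G.kCircularMatroid hE k hk).IsCocircuit (G.incidenceSet x) := by
  refine isCocircuit_of_eRk_compl_add_one (G.incidenceSet_subset_edgeSet x) ?_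
    fun e => notMem_closure_sdiff_incidenceSet
  rw [kCircularMatroid_ground, eRk_add_one_of_isCactiGraph sdiff_subset hcacti hexcess, hends,
    eRank_eq_encard_sdiff_singleton_add hrank hx]

lemma exists_endSet_compl_eq_of_isCocircuit (hK : (G.kCircularMatroid hE k hk).IsCocircuit K)
    (hcacti : (G.edgeInduce (G.edgeSet \ K)).IsCactiGraph)
    (hexcess : (k : ℤ) ≤ edgeExcess G (G.edgeSet \ K)) :
    ∃ x ∈ G.vertexSet, G.endSet (G.edgeSet \ K) = G.vertexSet \ {x} := by
  have hcompl : (G.endSet (G.edgeSet \ K)).encard + k = (G.kCircularMatroid hE k hk).eRank := by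
    rw [← eRk_add_one_of_isCactiGraph sdiff_subset hcacti hexcess]
    exact eRk_compl_add_one_of_isCocircuit hK
  have hfin : (G.endSet (G.edgeSet \ K)).encard + k ≠ ⊤ :=
    hcompl ▸ (Matroid.eRank_ne_top_iff _).2 inferInstance
  have hsub : G.endSet (G.edgeSet \ K) ⊆ G.vertexSet := endSet_subset_vertexSet
  have hsum : (G.vertexSet \ G.endSet (G.edgeSet \ K)).encard +
      ((G.endSet (G.edgeSet \ K)).encard + k) = 1 + ((G.endSet (G.edgeSet \ K)).encard + k) := by
    rw [← add_assoc, encard_sdiff_add_encard_of_subset hsub, ← hrank, ← hcompl, add_comm]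
  obtain ⟨x, hx⟩ := encard_eq_one.1 (ENat.add_left_injective_of_ne_top hfin hsum)
  exact ⟨x, (hx.ge rfl).1, by rw [← hx, sdiff_sdiff_cancel_left hsub]⟩

lemma exists_eq_incidenceSet_of_isCocircuit (hK : (G.kCircularMatroid hE k hk).IsCocircuit K)
    (hcacti : (G.edgeInduce (G.edgeSet \ K)).IsCactiGraph)
    (hexcess : (k : ℤ) ≤ edgeExcess G (G.edgeSet \ K)) :
    ∃ x ∈ G.vertexSet, K = G.incidenceSet x ∧
      G.endSet (G.edgeSet \ G.incidenceSet x) = G.vertexSet \ {x} := by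
  obtain ⟨x, hx, hends⟩ := exists_endSet_compl_eq_of_isCocircuit hrank hK hcacti hexcess
  have hxK : G.incidenceSet x ⊆ K := fun e he => by_contra fun heK =>
    (hends.subset ⟨e, ⟨he.edge_mem, heK⟩, he⟩).2 rfl
  have hmin := Matroid.isCocircuit_iff_minimal_compl_nonspanning.1 hK
  obtain rfl := hmin.eq_of_subset (not_spanning_sdiff_incidenceSet hrank hx) hxK
  exact ⟨x, hx, rfl, hends⟩

end FullRank

end VertexStar

end KCircular

open Set KCircular in
theorem mainTheorem5_general {α β : Type*} (G : Graph α β) (hE : G.edgeSet.Finite)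
    (k : ℕ) (hk : 1 ≤ k)
    (hrank : (G.kCircularMatroid hE k hk).eRank + 1 = G.vertexSet.encard + k) (K : Set β) :
    (G.kCircularMatroid hE k hk).IsNonseparatingCocircuit K ↔
      ∃ x ∈ G.vertexSet, K = G.incidenceSet x ∧
        (G.incidenceSet x).encard ≤ (G.kCircularMatroid hE k hk)✶.eRank ∧
        (k = 1 → (G.deleteVerts {x}).IsCactus) ∧
        (2 ≤ k → (G.deleteVerts {x}).IsCactiGraph) := by
  rw [Matroid.IsNonseparatingCocircuit, Matroid.delete_eq_restrict, Graph.kCircularMatroid_ground,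
    restrict_isConnected_iff sdiff_subset]
  constructor
  · rintro ⟨hK, hcacti, hexcess, hconn⟩
    obtain ⟨x, hx, rfl, hends⟩ := exists_eq_incidenceSet_of_isCocircuit hrank hK hcacti hexcess
    have hcorank := (encard_incidenceSet_le_eRank_dual_iff hrank hx hends).2 hexcess
    rw [edgeInduce_eq_deleteVerts hends] at hcacti hconn
    exact ⟨x, hx, rfl, hcorank, fun h => ⟨hcacti, hconn h⟩, fun _ => hcacti⟩
  · rintro ⟨x, hx, rfl, hcorank, hone, htwo⟩
    have hcacti : (G.deleteVerts {x}).IsCactiGraph :=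
      hk.eq_or_lt.elim (fun h => (hone h.symm).1) htwo
    have hends := endSet_sdiff_incidenceSet hcacti.not_isolated
    rw [← edgeInduce_eq_deleteVerts hends] at hcacti hone
    have hexcess := (encard_incidenceSet_le_eRank_dual_iff hrank hx hends).1 hcorank
    have hcocircuit := isCocircuit_incidenceSet hrank hx hends hcacti hexcess
    exact ⟨hcocircuit, hcacti, hexcess, fun h => (hone h).2⟩

theorem mainTheorem5 {α β : Type*} (G : Graph α β)
    (hV : G.vertexSet.Finite) (hE : G.edgeSet.Finite) (hG : ∀ v, ¬ G.IsIsolated v)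
    (k : ℕ) (hk : 1 ≤ k) (hM : (G.kCircularMatroid hE k hk).IsConnected) (K : Set β) :
    (G.kCircularMatroid hE k hk).IsNonseparatingCocircuit K ↔
      ∃ x ∈ G.vertexSet, K = G.incidenceSet x ∧
        (G.incidenceSet x).encard ≤ (G.kCircularMatroid hE k hk)✶.eRank ∧
        (k = 1 → (G.deleteVerts {x}).IsCactus) ∧
        (2 ≤ k → (G.deleteVerts {x}).IsCactiGraph) :=
  mainTheorem5_general G hE k hk (KCircular.eRank_add_one_of_isConnected hG hM) K
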